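/- Let $A$ be a discrete valuation ring with uniformizing parameter $\tau$, let $R=A[x_1,\dots,x_n]$, let $I\subset R$ be an ideal, and put $B=R/I$, $Y=\operatorname{Spec} B$, $T=\operatorname{Spec} A$. For a prime $P$ of $B$ lying over the prime $\mathfrak p=P\cap A$ of $A$, the dimension of the closed subset $V(P)\subset Y$, as a scheme of finite type over $T$, means $$\dim (A/\mathfrak p)+\operatorname{trdeg}_{\kappa(\mathfrak p)}\kappa(P),$$ and $Y$ is called equidimensional if all its irreducible components (the sets $V(P)$ with $P$ a minimal prime of $B$) have the same dimension in this sense. (For a component that meets the closed fiber of $Y\to T$ this is the Krull dimension of $B/P$.) An embedded prime of $B$ is an associated prime of $B$ that is not minimal; $Y$ has no embedded components if $B$ has no embedded primes; and $Y\to T$ is internally flat if each embedded prime of $B$ contracts to $0$ in $A$. Suppose that $Y$ is equidimensional, and let $J\subset I$ be an ideal generated by a regular sequence in $R$ whose length is the height of $I$. Then: 1. $Y$ has no embedded components $\iff J:(J:I)\subset I$; 2. $Y\to T$ is flat $\iff I:\tau\subset I$; 3. $Y\to T$ is internally flat $\iff (I:\tau)\cap (J:(J:I))\subset I$. -/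

import Mathlib

/-- The embedded primes of a ring `B`: the associated primes of `B` that are not minimal. -/
def embeddedPrimes (B : Type*) [CommRing B] : Set (Ideal B) :=
  associatedPrimes B B \ minimalPrimes B

/-- The affine scheme `Spec B` has no embedded components. -/
def HasNoEmbeddedComponents (B : Type*) [CommRing B] : Prop :=
  embeddedPrimes B = ∅

/-- The morphism `Spec B → Spec A` is internally flat: each embedded prime of `B`
contracts to zero in `A`. -/
def IsInternallyFlat (A B : Type*) [CommRing A] [CommRing B] [Algebra A B] : Prop :=
  ∀ P ∈ embeddedPrimes B, P.comap (algebraMap A B) = ⊥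

/-- The dimension of the closed subset `V = V(P)` of `Spec B`, for a prime `P`, where `Spec B` is
regarded as a scheme of finite type over the base `Spec A`: the dimension of the closure of the
image of `V` in `Spec A` (that is, of `Spec (A ⧸ 𝔭)`, where `𝔭 = P ∩ A`), plus the transcendence
degree of the function field of `V` over the residue field of `𝔭` (that is, of the domain `B ⧸ P`
over the domain `A ⧸ 𝔭`). -/
noncomputable def componentDim (A : Type*) {B : Type*} [CommRing A] [CommRing B] [Algebra A B]
    (P : Ideal B) : WithBot ℕ∞ :=
  ringKrullDim (A ⧸ P.under A) +
    ((Cardinal.toENat (Algebra.trdeg (A ⧸ P.under A) (B ⧸ P)) : ℕ∞) : WithBot ℕ∞)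

/-- `Spec B` is equidimensional as a scheme over `Spec A`: all its irreducible components have the
same dimension. -/
def IsEquidimensionalOver (A B : Type*) [CommRing A] [CommRing B] [Algebra A B] : Prop :=
  ∀ P ∈ minimalPrimes B, ∀ Q ∈ minimalPrimes B, componentDim A P = componentDim A Q

/-! Write U = J:(J:I). The point is that the embedded primes of R/I are exactly the associated
primes of U/I. Two facts about the regular ring R give this.

First, J is unmixed: every associated prime of R/J has height ht I. The same holds for R/(J:K) for
any K, since J:K is a finite intersection of ideals J:g. So a prime containing I and associated to
R/U is minimal over I, and a non-minimal associated prime of R/I must already occur in U/I.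

Second, at a minimal prime P of I of height ht I the ring R_P/J_P is Artinian Gorenstein, where
taking annihilators twice returns every ideal. So U_P = I_P and P is not associated to U/I.
Equidimensionality makes every minimal prime of I have height ht I, by the formula dim V(P) + ht P =
n + 1.

Now (1) says that U/I vanishes iff it has no associated prime. (3) says that τ lies in no associated
prime of U/I iff τ kills no nonzero element of U/I; every nonzero prime of A contains τ. (2) is
independent: over A, flatness means that τ acts injectively.

Both local facts come from comparing socles: over a Noetherian local ring, two regular sequences of
equal length have quotients with isomorphic socles (`socle_equiv_of_isRegular`). Compare with a
regular sequence generating the maximal ideal of a regular local ring: a sequence whose quotient has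
nonzero socle has full length, and full length forces a socle of length at most one. A length count
then gives the double annihilator property (`torsionBySet_annihilator_le_of_length_socle_le_one`).
-/

/-! ### Socles of quotients by regular sequences -/

/-- An injective linear map whose range contains the socle of the target identifies socles. -/
theorem socle_equiv_of_injective {R U V : Type*} [CommRing R] [AddCommGroup U] [Module R U]
    [AddCommGroup V] [Module R V] (𝔪 : Ideal R) (φ : U →ₗ[R] V) (hφ : Function.Injective φ)
    (h : Submodule.torsionBySet R V (𝔪 : Set R) ≤ LinearMap.range φ) :
    Nonempty (Submodule.torsionBySet R U (𝔪 : Set R) ≃ₗ[R]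
      Submodule.torsionBySet R V (𝔪 : Set R)) := by
  have hmap : ∀ x ∈ Submodule.torsionBySet R U (𝔪 : Set R),
      φ x ∈ Submodule.torsionBySet R V (𝔪 : Set R) := by
    intro x hx
    rw [Submodule.mem_torsionBySet_iff] at hx ⊢
    intro a
    rw [← map_smul, hx a, map_zero]
  refine ⟨LinearEquiv.ofBijective (φ.restrict hmap) ⟨?_, ?_⟩⟩
  · intro x y hxy
    exact Subtype.ext (hφ (congrArg Subtype.val hxy))
  · rintro ⟨v, hv⟩
    obtain ⟨u, rfl⟩ := h hv
    refine ⟨⟨u, ?_⟩, rfl⟩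
    rw [Submodule.mem_torsionBySet_iff] at hv ⊢
    intro a
    apply hφ
    rw [map_smul, hv a, map_zero]

theorem socle_equiv_of_linearEquiv {R U V : Type*} [CommRing R] [AddCommGroup U] [Module R U]
    [AddCommGroup V] [Module R V] (𝔪 : Ideal R) (e : U ≃ₗ[R] V) :
    Nonempty (Submodule.torsionBySet R U (𝔪 : Set R) ≃ₗ[R]
      Submodule.torsionBySet R V (𝔪 : Set R)) :=
  socle_equiv_of_injective 𝔪 e.toLinearMap e.injective
    (by rw [LinearEquiv.range]; exact le_top)

open Pointwise in
/-- Multiplication by `b` identifies the socle of `M / aM` with the socle of `M / abM`. -/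
theorem socle_equiv_quotSMulTop_mul {R M : Type*} [CommRing R] [AddCommGroup M] [Module R M]
    {𝔪 : Ideal R} {a b : R} (ha : a ∈ 𝔪) (hra : IsSMulRegular M a) (hrb : IsSMulRegular M b) :
    Nonempty (Submodule.torsionBySet R (QuotSMulTop a M) (𝔪 : Set R) ≃ₗ[R]
      Submodule.torsionBySet R (QuotSMulTop (a * b) M) (𝔪 : Set R)) := by
  have hle : a • (⊤ : Submodule R M) ≤
      ((a * b) • (⊤ : Submodule R M)).comap (LinearMap.lsmul R M b) := by
    intro x hx
    obtain ⟨y, -, rfl⟩ := (Submodule.mem_smul_pointwise_iff_exists _ _ _).1 hx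
    refine (Submodule.mem_smul_pointwise_iff_exists _ _ _).2 ⟨y, trivial, ?_⟩
    simp [mul_smul, smul_comm a b]
  refine socle_equiv_of_injective 𝔪 (Submodule.mapQ _ _ (LinearMap.lsmul R M b) hle) ?_ ?_
  · rw [← LinearMap.ker_eq_bot, LinearMap.ker_eq_bot']
    intro x hx
    obtain ⟨x, rfl⟩ := Submodule.Quotient.mk_surjective _ x
    rw [Submodule.mapQ_apply, Submodule.Quotient.mk_eq_zero,
      Submodule.mem_smul_pointwise_iff_exists] at hx
    obtain ⟨y, -, hy⟩ := hx
    rw [Submodule.Quotient.mk_eq_zero, Submodule.mem_smul_pointwise_iff_exists]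
    refine ⟨y, trivial, hrb ?_⟩
    simpa [mul_smul, smul_comm a b] using hy
  · intro v hv
    obtain ⟨x, rfl⟩ := Submodule.Quotient.mk_surjective _ v
    have h := (Submodule.mem_torsionBySet_iff _ _).1 hv ⟨a, ha⟩
    rw [← Submodule.Quotient.mk_smul, Submodule.Quotient.mk_eq_zero,
      Submodule.mem_smul_pointwise_iff_exists] at h
    obtain ⟨y, -, hy⟩ := h
    refine ⟨Submodule.Quotient.mk y, ?_⟩
    rw [Submodule.mapQ_apply]
    congr 1
    apply hra
    simpa [mul_smul] using hy

/-- Both socles agree with the socle of M/abM. -/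
theorem socle_equiv_quotSMulTop {R M : Type*} [CommRing R] [AddCommGroup M] [Module R M]
    {𝔪 : Ideal R} {a b : R} (ha : a ∈ 𝔪) (hb : b ∈ 𝔪) (hra : IsSMulRegular M a)
    (hrb : IsSMulRegular M b) :
    Nonempty (Submodule.torsionBySet R (QuotSMulTop a M) (𝔪 : Set R) ≃ₗ[R]
      Submodule.torsionBySet R (QuotSMulTop b M) (𝔪 : Set R)) := by
  obtain ⟨e⟩ := socle_equiv_quotSMulTop_mul ha hra hrb
  obtain ⟨f⟩ := socle_equiv_quotSMulTop_mul hb hrb hra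
  rw [mul_comm] at f
  exact ⟨e.trans f.symm⟩

/-- Prime avoidance: the zero divisors on M and N form a finite union of associated primes, none of
which contains I. -/
theorem exists_mem_isSMulRegular_isSMulRegular {R M N : Type*} [CommRing R] [IsNoetherianRing R]
    [AddCommGroup M] [Module R M] [Module.Finite R M] [AddCommGroup N] [Module R N]
    [Module.Finite R N] {I : Ideal R} {a b : R} (ha : a ∈ I) (hb : b ∈ I)
    (hra : IsSMulRegular M a) (hrb : IsSMulRegular N b) :
    ∃ z ∈ I, IsSMulRegular M z ∧ IsSMulRegular N z := by
  have hfin : (associatedPrimes R M ∪ associatedPrimes R N).Finite :=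
    (associatedPrimes.finite R M).union (associatedPrimes.finite R N)
  have hM := biUnion_associatedPrimes_eq_compl_regular R M
  have hN := biUnion_associatedPrimes_eq_compl_regular R N
  have key : ¬ ((I : Set R) ⊆ ⋃ P ∈ associatedPrimes R M ∪ associatedPrimes R N, (P : Set R)) := by
    intro h
    obtain ⟨P, hP, hIP⟩ := (Ideal.subset_union_prime_finite (f := id) hfin ⊥ ⊥ (by
      rintro P (hP | hP) - -
      · exact hP.isPrime
      · exact hP.isPrime)).1 h
    rcases hP with hP | hP
    · exact (hM.subset (Set.mem_biUnion hP (hIP ha))) hra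
    · exact (hN.subset (Set.mem_biUnion hP (hIP hb))) hrb
  obtain ⟨z, hz, hz'⟩ := Set.not_subset.1 key
  rw [Set.biUnion_union, hM, hN] at hz'
  simp only [Set.mem_union, not_or, Set.mem_compl_iff, not_not] at hz'
  exact ⟨z, hz, hz'⟩

section

open RingTheory.Sequence IsLocalRing

theorem RingTheory.Sequence.IsRegular.mem_maximalIdeal {R M : Type*} [CommRing R] [IsLocalRing R]
    [AddCommGroup M] [Module R M] {rs : List R} (h : IsRegular M rs) {r : R} (hr : r ∈ rs) :
    r ∈ maximalIdeal R := by
  by_contra hu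
  rw [IsLocalRing.mem_maximalIdeal, mem_nonunits_iff, not_not] at hu
  refine h.top_ne_smul ?_
  rw [Ideal.eq_top_of_isUnit_mem (Ideal.ofList rs) (Ideal.subset_span hr) hu, Submodule.top_smul]

/-- Regular sequences over a Noetherian local ring can be permuted, so an element regular modulo the
sequence may be moved to the front. -/
theorem isRegular_cons_of_isSMulRegular_quotient {R M : Type*} [CommRing R] [IsLocalRing R]
    [IsNoetherianRing R] [AddCommGroup M] [Module R M] [Module.Finite R M] [Nontrivial M]
    {rs : List R} {z : R} (h : IsWeaklyRegular M rs) (hrs : ∀ r ∈ rs, r ∈ maximalIdeal R)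
    (hz : z ∈ maximalIdeal R)
    (hzr : IsSMulRegular (M ⧸ (Ideal.ofList rs • ⊤ : Submodule R M)) z) :
    IsRegular M (z :: rs) := by
  have h1 : IsWeaklyRegular M (rs ++ [z]) :=
    (isWeaklyRegular_append_iff M _ _).2 ⟨h, (isWeaklyRegular_singleton_iff _ _).2 hzr⟩
  have h2 : IsRegular M (rs ++ [z]) :=
    (IsLocalRing.isRegular_iff_isWeaklyRegular_of_subset_maximalIdeal (by
      intro r hr
      rcases List.mem_append.1 hr with hr | hr
      · exact hrs r hr
      · rw [List.mem_singleton.1 hr]; exact hz)).2 h1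
  exact IsLocalRing.isRegular_of_perm h2 (List.perm_append_singleton z rs)

theorem isSMulRegular_quotient_of_isRegular_cons {R M : Type*} [CommRing R] [IsLocalRing R]
    [IsNoetherianRing R] [AddCommGroup M] [Module R M] [Module.Finite R M]
    {rs : List R} {z : R} (h : IsRegular M (z :: rs)) :
    IsWeaklyRegular M rs ∧ IsSMulRegular (M ⧸ (Ideal.ofList rs • ⊤ : Submodule R M)) z := by
  have h2 := IsLocalRing.isRegular_of_perm h (List.perm_append_singleton z rs).symm
  have h1 := (isWeaklyRegular_append_iff M _ _).1 h2.toIsWeaklyRegular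
  exact ⟨h1.1, (isWeaklyRegular_singleton_iff _ _).1 h1.2⟩

/-- The socles of the quotients by two regular sequences of equal length are isomorphic. -/
theorem socle_equiv_of_isRegular {R : Type*} [CommRing R] [IsLocalRing R] [IsNoetherianRing R] :
    ∀ {M : Type*} [AddCommGroup M] [Module R M] [Module.Finite R M] {as bs : List R},
    IsRegular M as → IsRegular M bs → as.length = bs.length →
    Nonempty (Submodule.torsionBySet R (M ⧸ (Ideal.ofList as • ⊤ : Submodule R M))
        (maximalIdeal R : Set R) ≃ₗ[R]
      Submodule.torsionBySet R (M ⧸ (Ideal.ofList bs • ⊤ : Submodule R M))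
        (maximalIdeal R : Set R)) := by
  intro M _ _ _ as
  induction as generalizing M with
  | nil =>
    intro bs _ _ hl
    obtain rfl := List.length_eq_zero_iff.1 hl.symm
    exact ⟨LinearEquiv.refl _ _⟩
  | cons a as ih =>
    intro bs ha hb hl
    cases bs with
    | nil => simp at hl
    | cons b bs =>
      have hl' : as.length = bs.length := by simpa using hl
      have hnt := ha.nontrivial
      obtain ⟨ha1, ha2⟩ := isSMulRegular_quotient_of_isRegular_cons ha
      obtain ⟨hb1, hb2⟩ := isSMulRegular_quotient_of_isRegular_cons hb
      have ham := ha.mem_maximalIdeal (List.mem_cons_self (a := a))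
      have hbm := hb.mem_maximalIdeal (List.mem_cons_self (a := b))
      -- A common z replaces both heads a and b without changing the socles; the two tails are then
      -- regular on M/zM, where induction applies.
      obtain ⟨z, hz, hz1, hz2⟩ := exists_mem_isSMulRegular_isSMulRegular ham hbm ha2 hb2
      have hza := ((isRegular_cons_iff M _ _).1 (isRegular_cons_of_isSMulRegular_quotient ha1
        (fun r hr => ha.mem_maximalIdeal (List.mem_cons_of_mem _ hr)) hz hz1)).2
      have hzb := ((isRegular_cons_iff M _ _).1 (isRegular_cons_of_isSMulRegular_quotient hb1
        (fun r hr => hb.mem_maximalIdeal (List.mem_cons_of_mem _ hr)) hz hz2)).2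
      have outer := fun (x : R) (xs : List R) => socle_equiv_of_linearEquiv (maximalIdeal R)
        (Submodule.quotOfListConsSMulTopEquivQuotSMulTopOuter M x xs)
      have inner := fun (x : R) (xs : List R) => socle_equiv_of_linearEquiv (maximalIdeal R)
        (Submodule.quotOfListConsSMulTopEquivQuotSMulTopInner M x xs)
      obtain ⟨e1⟩ := outer a as
      obtain ⟨e2⟩ := socle_equiv_quotSMulTop ham hz ha2 hz1
      obtain ⟨e3⟩ := outer z as
      obtain ⟨e4⟩ := inner z as
      obtain ⟨e5⟩ := ih hza hzb hl'
      obtain ⟨f4⟩ := inner z bs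
      obtain ⟨f3⟩ := outer z bs
      obtain ⟨f2⟩ := socle_equiv_quotSMulTop hbm hz hb2 hz2
      obtain ⟨f1⟩ := outer b bs
      exact ⟨(e1.trans <| e2.trans <| e3.symm.trans <| e4.trans <| e5.trans <| f4.symm.trans <|
        f3.trans <| f2.symm.trans f1.symm)⟩

end

/-! ### Length counts and the double annihilator property -/

open IsLocalRing in
/-- Over a local ring, the module of homomorphisms into a module with socle of length at most one
is no longer than the source. -/
theorem length_linearMap_le_of_length_socle_le_one {R : Type*} [CommRing R] [IsLocalRing R]
    {C : Type*} [AddCommGroup C] [Module R C]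
    (hC : Module.length R (Submodule.torsionBySet R C (maximalIdeal R : Set R)) ≤ 1)
    {M : Type*} [AddCommGroup M] [Module R M] (hM : IsFiniteLength R M) :
    Module.length R (M →ₗ[R] C) ≤ Module.length R M := by
  induction hM with
  | of_subsingleton => simp
  | @of_simple_quotient M _ _ N hs hN ih =>
    let f : (M →ₗ[R] C) →ₗ[R] (N →ₗ[R] C) := LinearMap.lcomp R C N.subtype
    rw [Module.length_eq_add_of_exact (LinearMap.ker f).subtype f.rangeRestrict
        (Submodule.subtype_injective _) (LinearMap.surjective_rangeRestrict f)
        (by rw [LinearMap.exact_iff]; simp),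
      Module.length_eq_add_of_exact N.subtype N.mkQ (Submodule.subtype_injective _)
        (Submodule.mkQ_surjective _) (LinearMap.exact_subtype_mkQ N), add_comm]
    refine add_le_add ((Module.length_le_of_injective (LinearMap.range f).subtype
      (Submodule.subtype_injective _)).trans ih) ?_
    rw [Module.length_eq_one R (M ⧸ N)]
    refine le_trans ?_ hC
    have hann : Module.annihilator R (M ⧸ N) = maximalIdeal R :=
      eq_maximalIdeal IsSimpleModule.annihilator_isMaximal
    have := IsSimpleModule.nontrivial R (M ⧸ N)
    obtain ⟨v, hv⟩ := exists_ne (0 : M ⧸ N)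
    obtain ⟨x, rfl⟩ := Submodule.Quotient.mk_surjective N v
    have hker : ∀ g ∈ LinearMap.ker f, ∀ y ∈ N, g y = 0 := by
      intro g hg y hy
      exact LinearMap.congr_fun (LinearMap.mem_ker.1 hg) ⟨y, hy⟩
    -- Maps vanishing on N factor through the simple module M/N, which is generated by x and killed
    -- by the maximal ideal; evaluation at x embeds them in the socle of C.
    let ev : LinearMap.ker f →ₗ[R] Submodule.torsionBySet R C (maximalIdeal R : Set R) :=
      ((LinearMap.applyₗ x).comp (LinearMap.ker f).subtype).codRestrict _ (by
        rintro ⟨g, hg⟩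
        rw [Submodule.mem_torsionBySet_iff]
        rintro ⟨a, ha⟩
        have hax : a • x ∈ N := by
          rw [← Submodule.Quotient.mk_eq_zero, Submodule.Quotient.mk_smul]
          rw [SetLike.mem_coe, ← hann, Module.mem_annihilator] at ha
          exact ha _
        simpa using hker g hg _ hax)
    refine Module.length_le_of_injective ev ?_
    rw [← LinearMap.ker_eq_bot, LinearMap.ker_eq_bot']
    rintro ⟨g, hg⟩ h0
    have hgx : g x = 0 := congrArg Subtype.val h0
    ext y
    obtain ⟨r, hr⟩ := Submodule.mem_span_singleton.1
      ((IsSimpleModule.span_singleton_eq_top R hv).symm ▸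
        (Submodule.mem_top : Submodule.Quotient.mk (p := N) y ∈ ⊤))
    have : r • x - y ∈ N := by
      rw [← Submodule.Quotient.mk_eq_zero, Submodule.Quotient.mk_sub, Submodule.Quotient.mk_smul,
        hr, sub_self]
    have := hker g hg _ this
    rw [map_sub, map_smul, hgx, smul_zero, zero_sub, neg_eq_zero] at this
    exact this

open IsLocalRing in
/-- A finite length module over a local ring whose socle has length at most one satisfies the
double annihilator property. -/
theorem torsionBySet_annihilator_le_of_length_socle_le_one {R : Type*} [CommRing R] [IsLocalRing R]
    {C : Type*} [AddCommGroup C] [Module R C] (hfl : IsFiniteLength R C)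
    (hC : Module.length R (Submodule.torsionBySet R C (maximalIdeal R : Set R)) ≤ 1)
    (N : Submodule R C) :
    Submodule.torsionBySet R C (N.annihilator : Set R) ≤ N := by
  have hfl' := isFiniteLength_iff_isNoetherian_isArtinian.1 hfl
  have := hfl'.1
  have := hfl'.2
  have hN : IsFiniteLength R N := isFiniteLength_iff_isNoetherian_isArtinian.2
    ⟨inferInstance, inferInstance⟩
  -- R/ann N embeds in Hom(N, C) by scalars acting on the inclusion, and below 0 :_C ann N embeds in
  -- Hom(R/ann N, C). Bounding both Homs gives length(0 :_C ann N) ≤ length N, although N is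
  -- contained in it.
  have h1 : Module.length R (R ⧸ N.annihilator) ≤ Module.length R N := by
    refine le_trans ?_ (length_linearMap_le_of_length_socle_le_one hC hN)
    have hker : N.annihilator = LinearMap.ker (LinearMap.toSpanSingleton R (N →ₗ[R] C) N.subtype) := by
      ext r
      rw [Submodule.mem_annihilator, LinearMap.mem_ker, LinearMap.ext_iff]
      simp
    refine Module.length_le_of_injective
      (N.annihilator.liftQ (LinearMap.toSpanSingleton R (N →ₗ[R] C) N.subtype) hker.le) ?_
    rw [← LinearMap.ker_eq_bot, Submodule.ker_liftQ_eq_bot' _ _ hker]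
  have h2 : Module.length R (Submodule.torsionBySet R C (N.annihilator : Set R)) ≤
      Module.length R (R ⧸ N.annihilator) := by
    have hq : IsFiniteLength R (R ⧸ N.annihilator) := Module.length_ne_top_iff.1
      (ne_top_of_le_ne_top (Module.length_ne_top_iff.2 hN) h1)
    refine le_trans ?_ (length_linearMap_le_of_length_socle_le_one hC hq)
    let F : Submodule.torsionBySet R C (N.annihilator : Set R) →ₗ[R]
        ((R ⧸ N.annihilator) →ₗ[R] C) :=
      { toFun := fun v => N.annihilator.liftQ (LinearMap.toSpanSingleton R C v) (by
          intro r hr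
          exact (Submodule.mem_torsionBySet_iff _ _).1 v.2 ⟨r, hr⟩)
        map_add' := fun v w => LinearMap.ext fun x => by
          obtain ⟨x, rfl⟩ := Submodule.Quotient.mk_surjective _ x
          exact smul_add x (v : C) w
        map_smul' := fun r v => LinearMap.ext fun x => by
          obtain ⟨x, rfl⟩ := Submodule.Quotient.mk_surjective _ x
          exact smul_comm x r (v : C) }
    refine Module.length_le_of_injective F fun v w hvw => ?_
    have h : (1 : R) • (v : C) = (1 : R) • (w : C) :=
      LinearMap.congr_fun hvw (Submodule.Quotient.mk 1)
    rw [one_smul, one_smul] at h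
    exact Subtype.ext h
  have h3 := h2.trans h1
  have hle : N ≤ Submodule.torsionBySet R C (N.annihilator : Set R) := by
    intro v hv
    rw [Submodule.mem_torsionBySet_iff]
    exact fun a => Submodule.mem_annihilator.1 a.2 v hv
  by_contra hlt
  rw [Module.length_submodule, Module.length_submodule] at h3
  exact absurd (Submodule.height_strictMono (lt_of_le_not_ge hle hlt)) (not_lt.2 h3)

/-! ### Structure of regular local rings -/

section

open IsLocalRing RingTheory.Sequence

/-- Written in a minimal generating set, x has a unit coefficient because it lies outside the
square; it can replace that generator, which then disappears modulo x. -/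
theorem spanFinrank_maximalIdeal_quotient_span_singleton_le {R : Type*} [CommRing R]
    [IsLocalRing R] [IsNoetherianRing R] {x : R} [IsLocalRing (R ⧸ Ideal.span {x})]
    (hx : x ∈ maximalIdeal R) (hx2 : x ∉ maximalIdeal R ^ 2) :
    (maximalIdeal (R ⧸ Ideal.span {x})).spanFinrank + 1 ≤ (maximalIdeal R).spanFinrank := by
  classical
  obtain ⟨s, hscard, hs⟩ := Submodule.FG.exists_span_finset_card_eq_spanFinrank
    (maximalIdeal R).fg_of_isNoetherianRing
  have hsm : ∀ y ∈ s, y ∈ maximalIdeal R := fun y hy => hs ▸ Submodule.subset_span hy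
  obtain ⟨f, -, hf⟩ := Submodule.mem_span_finset.1 (hs.symm ▸ hx : x ∈ Submodule.span R (s : Set R))
  obtain ⟨y, hys, hy⟩ : ∃ y ∈ s, f y ∉ maximalIdeal R := by
    by_contra! h
    refine hx2 (hf ▸ Ideal.sum_mem _ fun y hy => ?_)
    rw [pow_two]
    exact Ideal.mul_mem_mul (h y hy) (hsm y hy)
  have hu : IsUnit (f y) := by simpa using hy
  have hspan : maximalIdeal R ≤ Ideal.span (insert x (s.erase y : Set R)) := by
    rw [← hs]
    refine Submodule.span_le.2 fun z hz => ?_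
    by_cases hzy : z = y
    · subst hzy
      have h1 : f z * z = x - ∑ a ∈ s.erase z, f a • a := by
        rw [← hf, ← Finset.add_sum_erase _ _ hys, smul_eq_mul]
        ring
      refine (Ideal.unit_mul_mem_iff_mem _ hu).1 ?_
      rw [h1]
      exact Ideal.sub_mem _ (Ideal.subset_span (Set.mem_insert _ _))
        (Ideal.sum_mem _ fun a ha => Ideal.mul_mem_left _ _
          (Ideal.subset_span (Set.mem_insert_of_mem _ ha)))
    · exact Ideal.subset_span (Set.mem_insert_of_mem _ (Finset.mem_erase.2 ⟨hzy, hz⟩))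
  have hmax : maximalIdeal (R ⧸ Ideal.span {x}) =
      Ideal.span (((s.erase y).image (Ideal.Quotient.mk (Ideal.span {x})) : Finset _) :
        Set (R ⧸ Ideal.span {x})) := by
    apply le_antisymm
    · intro z hz
      obtain ⟨z, rfl⟩ := Ideal.Quotient.mk_surjective z
      have hz' : z ∈ maximalIdeal R := by
        rw [IsLocalRing.mem_maximalIdeal, mem_nonunits_iff] at hz ⊢
        exact fun h => hz (h.map _)
      have := Ideal.mem_map_of_mem (Ideal.Quotient.mk (Ideal.span {x})) (hspan hz')
      rw [Ideal.map_span, Set.image_insert_eq, Ideal.span_insert,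
        Ideal.Quotient.eq_zero_iff_mem.2 (Ideal.mem_span_singleton_self x)] at this
      simpa using this
    · refine Ideal.span_le.2 ?_
      intro z hz
      obtain ⟨w, hw, rfl⟩ := Finset.mem_image.1 hz
      have := hsm w (Finset.mem_of_mem_erase hw)
      rw [SetLike.mem_coe, IsLocalRing.mem_maximalIdeal, mem_nonunits_iff]
      intro hunit
      obtain ⟨v, hv⟩ := isUnit_iff_exists_inv.1 hunit
      obtain ⟨v, rfl⟩ := Ideal.Quotient.mk_surjective v
      rw [← map_mul, ← map_one (Ideal.Quotient.mk (Ideal.span {x})), Ideal.Quotient.eq] at hv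
      have h1 : w * v - 1 ∈ maximalIdeal R :=
        (Ideal.span_singleton_le_iff_mem (maximalIdeal R)).2 hx hv
      have h2 := Ideal.sub_mem _ (Ideal.mul_mem_right v _ this) h1
      rw [sub_sub_cancel] at h2
      exact (Ideal.ne_top_iff_one _).1 (maximalIdeal.isMaximal R).ne_top h2
  rw [hmax, ← hscard, ← Finset.card_erase_add_one hys]
  refine Nat.add_le_add_right ?_ 1
  refine (Submodule.spanFinrank_span_le_ncard_of_finite (Finset.finite_toSet _)).trans ?_
  rw [Set.ncard_coe_finset]
  exact Finset.card_image_le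

/-- In a Noetherian local ring of positive dimension, the maximal ideal has an element outside its
square and outside all minimal primes. -/
theorem exists_mem_maximalIdeal_notMem_sq_notMem_minimalPrimes {R : Type*} [CommRing R]
    [IsLocalRing R] [IsNoetherianRing R] (h : maximalIdeal R ∉ minimalPrimes R) :
    ∃ x ∈ maximalIdeal R, x ∉ maximalIdeal R ^ 2 ∧ ∀ q ∈ minimalPrimes R, x ∉ q := by
  have hfin : (insert (maximalIdeal R ^ 2) (minimalPrimes R)).Finite :=
    (minimalPrimes.finite_of_isNoetherianRing R).insert _
  have key : ¬ ((maximalIdeal R : Set R) ⊆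
      ⋃ P ∈ insert (maximalIdeal R ^ 2) (minimalPrimes R), (P : Set R)) := by
    intro hsub
    -- Prime avoidance tolerates two non-prime ideals; the square of the maximal ideal is the only
    -- one here and fills both slots.
    obtain ⟨P, hP, hle⟩ := (Ideal.subset_union_prime_finite (f := id) hfin
      (maximalIdeal R ^ 2) (maximalIdeal R ^ 2) (by
        rintro P (rfl | hP) h1 -
        · exact absurd rfl h1
        · exact hP.isPrime)).1 hsub
    rcases hP with rfl | hP
    · have hbot : maximalIdeal R = ⊥ := Submodule.eq_bot_of_le_smul_of_le_jacobson_bot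
        (maximalIdeal R) _ (maximalIdeal R).fg_of_isNoetherianRing
        (by rw [smul_eq_mul, ← pow_two]; exact hle) (maximalIdeal_le_jacobson _)
      refine h ⟨⟨inferInstance, bot_le⟩, fun Q _ _ => ?_⟩
      rw [hbot]
      exact bot_le
    · refine h ⟨⟨inferInstance, bot_le⟩, fun Q hQ _ => ?_⟩
      exact hle.trans (hP.2 hQ (le_maximalIdeal hQ.1.ne_top |>.trans hle))
  obtain ⟨x, hx, hx'⟩ := Set.not_subset.1 key
  rw [Set.mem_iUnion₂] at hx'
  push Not at hx'
  exact ⟨x, hx, hx' _ (Set.mem_insert _ _), fun q hq => hx' q (Set.mem_insert_of_mem _ hq)⟩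

/-- A minimal prime q inside (x) does not contain x, so q = xq, and Nakayama gives q = 0. -/
theorem isDomain_of_isPrime_span_singleton {R : Type*} [CommRing R] [IsLocalRing R]
    [IsNoetherianRing R] {x : R} (hx : x ∈ maximalIdeal R) (hp : (Ideal.span {x}).IsPrime)
    (hmin : ∀ q ∈ minimalPrimes R, x ∉ q) : IsDomain R := by
  obtain ⟨q, hq, hqx⟩ := Ideal.exists_minimalPrimes_le (bot_le : (⊥ : Ideal R) ≤ Ideal.span {x})
  have hqp := hq.isPrime
  have hbot : q = ⊥ := by
    refine Submodule.eq_bot_of_le_smul_of_le_jacobson_bot (maximalIdeal R) q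
      q.fg_of_isNoetherianRing (fun a ha => ?_) (maximalIdeal_le_jacobson _)
    obtain ⟨b, rfl⟩ := Ideal.mem_span_singleton'.1 (hqx ha)
    rw [mul_comm]
    exact Submodule.smul_mem_smul hx ((hqp.mem_or_mem ha).resolve_right (hmin q hq))
  rw [hbot] at hqp
  exact IsDomain.of_bot_isPrime R

theorem isRegular_cons_of_isRegular_quotient {R : Type*} [CommRing R] [IsLocalRing R]
    {x : R} (hx : x ∈ maximalIdeal R) (hreg : IsSMulRegular R x) {rs : List R}
    (hrs : IsRegular (R ⧸ Ideal.span {x}) (rs.map (Ideal.Quotient.mk (Ideal.span {x}))))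
    (hmem : ∀ r ∈ rs, r ∈ maximalIdeal R) : IsRegular R (x :: rs) := by
  refine (IsLocalRing.isRegular_iff_isWeaklyRegular_of_subset_maximalIdeal (by
    simpa using ⟨hx, hmem⟩)).2 ?_
  rw [isWeaklyRegular_cons_iff]
  refine ⟨hreg, ?_⟩
  have h1 : IsWeaklyRegular (R ⧸ Ideal.span {x}) rs :=
    (isWeaklyRegular_map_algebraMap_iff (R ⧸ Ideal.span {x}) _ rs).1 hrs.toIsWeaklyRegular
  refine (LinearEquiv.isWeaklyRegular_congr (Submodule.quotEquivOfEq _ _ ?_) rs).1 h1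
  rw [← Submodule.ideal_span_singleton_smul]
  simp

/-- A regular local ring is a domain and its maximal ideal is generated by a regular sequence. -/
theorem IsRegularLocalRing.isDomain_and_exists_isRegular (d : ℕ) :
    ∀ (R : Type*) [CommRing R] [IsRegularLocalRing R], ringKrullDim R = d →
    IsDomain R ∧ ∃ rs : List R, IsRegular R rs ∧ Ideal.ofList rs = maximalIdeal R ∧
      rs.length = d := by
  induction d with
  | zero =>
    intro R _ _ hd
    have h := (isRegularLocalRing_iff R).1 ‹_›
    rw [hd, Nat.cast_inj, Submodule.spanFinrank_eq_zero_iff_eq_bot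
      (maximalIdeal R).fg_of_isNoetherianRing] at h
    have hp := (maximalIdeal.isMaximal R).isPrime
    rw [h] at hp
    exact ⟨IsDomain.of_bot_isPrime R, [], IsRegular.nil R R, by rw [Ideal.ofList_nil, h], rfl⟩
  | succ d ih =>
    intro R _ _ hd
    have hspan := (isRegularLocalRing_iff R).1 ‹_›
    rw [hd, Nat.cast_inj] at hspan
    obtain ⟨x, hx, hx2, hxmin⟩ := exists_mem_maximalIdeal_notMem_sq_notMem_minimalPrimes (R := R) (by
      rw [← Ideal.height_eq_zero_iff]
      intro h0
      have := maximalIdeal_height_eq_ringKrullDim (R := R)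
      rw [h0, hd] at this
      exact absurd this (by norm_cast))
    have hne : Ideal.span {x} ≠ ⊤ := ne_top_of_le_ne_top (maximalIdeal.isMaximal R).ne_top
      ((Ideal.span_singleton_le_iff_mem _).2 hx)
    have : Nontrivial (R ⧸ Ideal.span {x}) := Ideal.Quotient.nontrivial_iff.2 hne
    have : IsLocalRing (R ⧸ Ideal.span {x}) := .of_surjective' _ Ideal.Quotient.mk_surjective
    have hle := spanFinrank_maximalIdeal_quotient_span_singleton_le hx hx2
    rw [hspan, Nat.add_le_add_iff_right] at hle
    have hdim : ((d : ℕ) : WithBot ℕ∞) ≤ ringKrullDim (R ⧸ Ideal.span {x}) := by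
      have h1 := ringKrullDim_le_ringKrullDim_quotient_add_card {x}
        (by simpa [ringJacobson_eq_maximalIdeal] using hx)
      rw [hd, Finset.coe_singleton, Finset.card_singleton, Nat.cast_add] at h1
      exact ENat.WithBot.add_le_add_natCast_right_iff.1 h1
    have hreg : IsRegularLocalRing (R ⧸ Ideal.span {x}) :=
      .of_spanFinrank_maximalIdeal_le _ ((Nat.cast_le.2 hle).trans hdim)
    have hdim' : ringKrullDim (R ⧸ Ideal.span {x}) = d := by
      refine le_antisymm ?_ hdim
      rw [← (isRegularLocalRing_iff _).1 hreg]
      exact Nat.cast_le.2 hle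
    obtain ⟨hdom, rs, hrs, hrsm, hrsl⟩ := ih (R ⧸ Ideal.span {x}) hdim'
    have hprime : (Ideal.span {x}).IsPrime := (Ideal.Quotient.isDomain_iff_prime _).1 hdom
    have hdomR := isDomain_of_isPrime_span_singleton hx hprime hxmin
    have hx0 : x ≠ 0 := fun h => hx2 (h ▸ Ideal.zero_mem _)
    obtain ⟨rs, rfl⟩ := List.map_surjective_iff.2 Ideal.Quotient.mk_surjective rs
    have hloc : IsLocalHom (Ideal.Quotient.mk (Ideal.span {x})) :=
      .of_surjective _ Ideal.Quotient.mk_surjective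
    have hcomap : Ideal.ofList (x :: rs) = maximalIdeal R := by
      rw [Ideal.ofList_cons]
      rw [← maximalIdeal_comap (Ideal.Quotient.mk (Ideal.span {x})), ← hrsm, ← Ideal.map_ofList,
        Ideal.comap_map_of_surjective' _ Ideal.Quotient.mk_surjective, Ideal.mk_ker, sup_comm]
    refine ⟨hdomR, x :: rs, isRegular_cons_of_isRegular_quotient hx
      (IsSMulRegular.of_ne_zero hx0) hrs fun r hr => ?_, hcomap, by simpa using hrsl⟩
    rw [← hcomap]
    exact Ideal.subset_span (List.mem_cons_of_mem _ hr)

end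

/-! ### Gorenstein quotients and localization -/

section

open IsLocalRing RingTheory.Sequence

theorem IsRegularLocalRing.exists_isRegular_ofList_eq_maximalIdeal (R : Type*) [CommRing R]
    [IsRegularLocalRing R] : ∃ rs : List R, IsRegular R rs ∧ Ideal.ofList rs = maximalIdeal R ∧
      (rs.length : WithBot ℕ∞) = ringKrullDim R := by
  have h := (isRegularLocalRing_iff R).1 ‹_›
  obtain ⟨-, rs, h1, h2, h3⟩ :=
    IsRegularLocalRing.isDomain_and_exists_isRegular _ R h.symm
  exact ⟨rs, h1, h2, by rw [h3, h]⟩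

/-- A regular sequence in a regular local ring whose quotient has depth zero has maximal length. -/
theorem IsRegularLocalRing.length_eq_ringKrullDim {R : Type*} [CommRing R] [IsRegularLocalRing R]
    {rs : List R} (hrs : IsRegular R rs)
    (hsoc : Submodule.torsionBySet R (R ⧸ (Ideal.ofList rs • ⊤ : Submodule R R))
      (maximalIdeal R : Set R) ≠ ⊥) :
    (rs.length : WithBot ℕ∞) = ringKrullDim R := by
  obtain ⟨ps, hps, hpm, hpl⟩ := exists_isRegular_ofList_eq_maximalIdeal R
  have hdim := ringKrullDim_add_length_eq_ringKrullDim_of_isRegular rs hrs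
  have hne : Ideal.ofList rs ≠ ⊤ := by
    intro h
    refine hrs.top_ne_smul ?_
    rw [h, Submodule.top_smul]
  have : Nontrivial (R ⧸ Ideal.ofList rs) := Ideal.Quotient.nontrivial_iff.2 hne
  have hle : rs.length ≤ ps.length := by
    have h0 := add_le_add_left (ringKrullDim_nonneg_of_nontrivial (R := R ⧸ Ideal.ofList rs))
      (rs.length : WithBot ℕ∞)
    rw [hdim, ← hpl, zero_add] at h0
    exact_mod_cast h0
  rcases hle.eq_or_lt with h | hlt
  · rw [← hpl, h]
  exfalso
  -- Cut the generating sequence `ps` down to the length of `rs`. The next element of `ps` is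
  -- regular on the quotient yet kills its socle, so the socle is zero, and hence so is that of the
  -- quotient by `rs`.
  have hw := hps.toIsWeaklyRegular
  rw [← List.take_append_drop rs.length ps, isWeaklyRegular_append_iff] at hw
  obtain ⟨hw1, hw2⟩ := hw
  rw [List.drop_eq_getElem_cons hlt, isWeaklyRegular_cons_iff] at hw2
  have hreg : IsRegular R (ps.take rs.length) :=
    (IsLocalRing.isRegular_iff_isWeaklyRegular_of_subset_maximalIdeal fun r hr =>
      hps.mem_maximalIdeal (List.mem_of_mem_take hr)).2 hw1
  obtain ⟨e⟩ := socle_equiv_of_isRegular hrs hreg (by simp [hle])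
  refine hsoc ((Submodule.eq_bot_iff _).2 fun v hv => ?_)
  have hev : ((e ⟨v, hv⟩ : _) : R ⧸ (Ideal.ofList (ps.take rs.length) • ⊤ : Submodule R R)) = 0 := by
    apply hw2.1
    have := (Submodule.mem_torsionBySet_iff _ _).1 (e ⟨v, hv⟩).2
      ⟨ps[rs.length], hps.mem_maximalIdeal (List.getElem_mem hlt)⟩
    simpa using this
  have h1 : e ⟨v, hv⟩ = 0 := Subtype.ext hev
  rw [LinearEquiv.map_eq_zero_iff] at h1
  exact congrArg Subtype.val h1

/-- The quotient of a regular local ring by a regular sequence of maximal length is Gorenstein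
of dimension zero: it has finite length and its socle has length one. -/
theorem IsRegularLocalRing.isFiniteLength_and_length_socle_le_one {R : Type*} [CommRing R]
    [IsRegularLocalRing R] {rs : List R} (hrs : IsRegular R rs)
    (hlen : (rs.length : WithBot ℕ∞) = ringKrullDim R) :
    IsFiniteLength R (R ⧸ Ideal.ofList rs) ∧
    Module.length R (Submodule.torsionBySet R (R ⧸ Ideal.ofList rs)
      (maximalIdeal R : Set R)) ≤ 1 := by
  have hsmul : ∀ xs : List R, (Ideal.ofList xs • ⊤ : Submodule R R) = Ideal.ofList xs := fun xs => by
    simp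
  constructor
  · have hdim := ringKrullDim_add_length_eq_ringKrullDim_of_isRegular rs hrs
    have hd : ringKrullDim (R ⧸ Ideal.ofList rs) = 0 := by
      rw [← hlen, ← zero_add (rs.length : WithBot ℕ∞), ← add_assoc, add_zero] at hdim
      exact ENat.WithBot.add_natCast_cancel.1 hdim
    have : Ring.KrullDimLE 0 (R ⧸ Ideal.ofList rs) := Ring.krullDimLE_iff.2 hd.le
    have : IsArtinianRing (R ⧸ Ideal.ofList rs) :=
      isArtinianRing_iff_isNoetherianRing_krullDimLE_zero.2 ⟨inferInstance, inferInstance⟩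
    rw [isFiniteLength_iff_isNoetherian_isArtinian]
    exact ⟨inferInstance, isArtinian_of_surjective_algebraMap (R := R ⧸ Ideal.ofList rs) (S := R)
      (show Function.Surjective (Ideal.Quotient.mk (Ideal.ofList rs)) from
        Ideal.Quotient.mk_surjective)⟩
  · obtain ⟨ps, hps, hpm, hpl⟩ := exists_isRegular_ofList_eq_maximalIdeal R
    obtain ⟨e⟩ := socle_equiv_of_isRegular hrs hps (by
      rw [← hlen] at hpl
      exact_mod_cast hpl.symm)
    obtain ⟨f⟩ := socle_equiv_of_linearEquiv (maximalIdeal R)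
      (Submodule.quotEquivOfEq _ _ (hsmul rs))
    obtain ⟨g⟩ := socle_equiv_of_linearEquiv (maximalIdeal R)
      (Submodule.quotEquivOfEq _ _ ((hsmul ps).trans hpm))
    rw [(f.symm.trans (e.trans g)).length_eq]
    have : IsSimpleModule R (R ⧸ maximalIdeal R) :=
      isSimpleModule_iff_isCoatom.2 (maximalIdeal.isMaximal R).out
    exact (Module.length_le_of_injective _ (Submodule.subtype_injective _)).trans
      (Module.length_eq_one R (R ⧸ maximalIdeal R)).le

/-- This is the double annihilator property of the finite length module R/(rs), applied to the image
of I. -/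
theorem IsRegularLocalRing.colon_colon_le {R : Type*} [CommRing R] [IsRegularLocalRing R]
    {rs : List R} (hrs : IsRegular R rs) (hlen : (rs.length : WithBot ℕ∞) = ringKrullDim R)
    {I : Ideal R} (hI : Ideal.ofList rs ≤ I) :
    (Ideal.ofList rs).colon ((Ideal.ofList rs).colon (I : Set R) : Set R) ≤ I := by
  obtain ⟨h1, h2⟩ := isFiniteLength_and_length_socle_le_one hrs hlen
  intro x hx
  have h3 := torsionBySet_annihilator_le_of_length_socle_le_one h1 h2
    (Submodule.map (Submodule.mkQ (Ideal.ofList rs)) I)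
  have h4 : Submodule.mkQ (Ideal.ofList rs) x ∈ Submodule.torsionBySet R _
      ((Submodule.map (Submodule.mkQ (Ideal.ofList rs)) I).annihilator : Set R) := by
    rw [Submodule.mem_torsionBySet_iff]
    rintro ⟨a, ha⟩
    have ha' : a ∈ (Ideal.ofList rs).colon (I : Set R) := by
      rw [Submodule.mem_colon]
      intro y hy
      have := Submodule.mem_annihilator.1 ha _ (Submodule.mem_map_of_mem hy)
      rwa [← map_smul, Submodule.mkQ_apply, Submodule.Quotient.mk_eq_zero] at this
    have := Submodule.mem_colon.1 hx a ha'
    rw [← map_smul, Submodule.mkQ_apply, Submodule.Quotient.mk_eq_zero]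
    rwa [smul_eq_mul, mul_comm] at this
  obtain ⟨y, hy, hxy⟩ := h3 h4
  have h5 : y - x ∈ Ideal.ofList rs := (Submodule.Quotient.eq _).1 hxy
  have := I.sub_mem hy (hI h5)
  rwa [sub_sub_cancel] at this

section Localization

variable {R : Type*} [CommRing R] [IsRegularRing R] {rs : List R}

/-- Unmixedness: associated primes of an ideal generated by a regular sequence have height equal
to the length of the sequence. -/
theorem IsRegularRing.height_eq_length (hrs : IsWeaklyRegular R rs) {P : Ideal R} [P.IsPrime]
    {x : R} (hP : ∀ r, r ∈ P ↔ r * x ∈ Ideal.ofList rs) : P.height = rs.length := by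
  have hmem : ∀ r ∈ rs, r ∈ P := fun r hr =>
    (hP r).2 (Ideal.mul_mem_right _ _ (Ideal.subset_span hr))
  have hreg := hrs.isRegular_of_isLocalization_of_mem (Localization.AtPrime P) P hmem
  have hx : algebraMap R (Localization.AtPrime P) x ∉
      (Ideal.ofList rs).map (algebraMap R (Localization.AtPrime P)) := by
    rw [IsLocalization.algebraMap_mem_map_algebraMap_iff P.primeCompl]
    rintro ⟨s, hs, hsx⟩
    exact hs ((hP s).2 hsx)
  have hm : maximalIdeal (Localization.AtPrime P) ≤
      ((Ideal.ofList rs).map (algebraMap R (Localization.AtPrime P))).colon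
        {algebraMap R (Localization.AtPrime P) x} := by
    rw [← Localization.AtPrime.map_eq_maximalIdeal, Ideal.map_le_iff_le_comap]
    intro r hr
    rw [Ideal.mem_comap, Submodule.mem_colon_singleton, smul_eq_mul, ← map_mul]
    exact Ideal.mem_map_of_mem _ ((hP r).1 hr)
  -- The class of x is a nonzero socle element of the quotient of R_P by the sequence.
  have h := IsRegularLocalRing.length_eq_ringKrullDim hreg (by
    rw [Submodule.ne_bot_iff]
    refine ⟨Submodule.Quotient.mk (algebraMap R (Localization.AtPrime P) x), ?_, ?_⟩
    · rw [Submodule.mem_torsionBySet_iff]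
      rintro ⟨a, ha⟩
      rw [← Submodule.Quotient.mk_smul, Submodule.Quotient.mk_eq_zero, smul_eq_mul,
        Ideal.mul_top, ← Ideal.map_ofList]
      exact Submodule.mem_colon_singleton.1 (hm ha)
    · rw [Ne, Submodule.Quotient.mk_eq_zero, smul_eq_mul, Ideal.mul_top, ← Ideal.map_ofList]
      exact hx)
  rw [IsLocalization.AtPrime.ringKrullDim_eq_height P, List.length_map] at h
  exact_mod_cast h.symm

/-- At a prime of height equal to the length of the regular sequence, linkage is an involution. -/
theorem IsRegularRing.exists_mul_mem_of_mem_colon_colon (hrs : IsWeaklyRegular R rs)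
    {P : Ideal R} [P.IsPrime] (hP : P.height = rs.length) {I : Ideal R}
    (hJI : Ideal.ofList rs ≤ I) (hIP : I ≤ P) {x : R}
    (hx : x ∈ (Ideal.ofList rs).colon ((Ideal.ofList rs).colon (I : Set R) : Set R)) :
    ∃ s ∉ P, s * x ∈ I := by
  classical
  let φ := algebraMap R (Localization.AtPrime P)
  have hmem : ∀ r ∈ rs, r ∈ P := fun r hr => hIP (hJI (Ideal.subset_span hr))
  have hreg := hrs.isRegular_of_isLocalization_of_mem (Localization.AtPrime P) P hmem
  have hlen : ((rs.map φ).length : WithBot ℕ∞) = ringKrullDim (Localization.AtPrime P) := by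
    rw [IsLocalization.AtPrime.ringKrullDim_eq_height P, List.length_map, hP]
    rfl
  have hcol := IsRegularLocalRing.colon_colon_le hreg hlen (I := I.map φ)
    (by rw [← Ideal.map_ofList]; exact Ideal.map_mono hJI)
  rw [← Ideal.map_ofList] at hcol
  have hxI : φ x ∈ I.map φ := by
    apply hcol
    rw [Submodule.mem_colon]
    intro y hy
    rw [SetLike.mem_coe, Submodule.mem_colon] at hy
    obtain ⟨⟨z, s⟩, hzs⟩ := IsLocalization.surj P.primeCompl y
    have hz : ∀ w ∈ I, ∃ t ∉ P, t * z * w ∈ Ideal.ofList rs := by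
      intro w hw
      have h1 := Ideal.mul_mem_left _ (φ s) (hy (φ w) (Ideal.mem_map_of_mem _ hw))
      have h2 : φ s * y • φ w = φ (z * w) := by
        rw [smul_eq_mul, ← mul_assoc, mul_comm (φ s), hzs, map_mul]
      rw [h2, IsLocalization.algebraMap_mem_map_algebraMap_iff P.primeCompl] at h1
      obtain ⟨t, ht, h⟩ := h1
      exact ⟨t, ht, by rwa [mul_assoc]⟩
    -- The denominators depend on w; since I is finitely generated, their product over generators
    -- serves all w at once and puts tz in J:I.
    obtain ⟨t, ht, htz⟩ : ∃ t ∉ P, ∀ w ∈ I, t * z * w ∈ Ideal.ofList rs := by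
      obtain ⟨G, hG⟩ := I.fg_of_isNoetherianRing
      choose! t ht h using hz
      refine ⟨∏ g ∈ G, t g, fun hmem => ?_, fun w hw => ?_⟩
      · obtain ⟨g, hg, hgP⟩ := (Ideal.IsPrime.prod_mem_iff).1 hmem
        exact ht g (hG ▸ Submodule.subset_span hg) hgP
      · have hle : I ≤ (Ideal.ofList rs).colon {(∏ g ∈ G, t g) * z} := by
          rw [← hG]
          refine Submodule.span_le.2 fun g hg => ?_
          rw [SetLike.mem_coe, Submodule.mem_colon_singleton, smul_eq_mul,
            ← Finset.mul_prod_erase _ _ hg]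
          have := Ideal.mul_mem_left _ (∏ g ∈ G.erase g, t g)
            (h g (hG ▸ Submodule.subset_span hg))
          convert this using 1
          ring
        have := Submodule.mem_colon_singleton.1 (hle hw)
        rwa [smul_eq_mul, mul_comm] at this
    have hxt : x * (t * z) ∈ Ideal.ofList rs := by
      refine Submodule.mem_colon.1 hx _ ?_
      rw [SetLike.mem_coe, Submodule.mem_colon]
      exact htz
    have h1 : φ x * (φ t * (y * φ s)) ∈ (Ideal.ofList rs).map φ := by
      rw [hzs, ← map_mul, ← map_mul]
      exact Ideal.mem_map_of_mem _ hxt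
    have hu : IsUnit (φ t * φ s) :=
      (IsLocalization.map_units (Localization.AtPrime P) (⟨t, ht⟩ : P.primeCompl)).mul
        (IsLocalization.map_units (Localization.AtPrime P) s)
    rw [← Ideal.unit_mul_mem_iff_mem _ hu, smul_eq_mul]
    convert h1 using 1
    ring
  rw [IsLocalization.algebraMap_mem_map_algebraMap_iff P.primeCompl] at hxI
  exact hxI

end Localization

end

/-! ### The dimension formula and equality of heights -/

open Polynomial in
-- Inverting the nonzero constants keeps the height of Q and lands in a principal ideal domain K[X].
theorem Polynomial.height_eq_one_of_comap_C_eq_bot {D : Type*} [CommRing D] [IsDomain D]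
    [IsNoetherianRing D] (Q : Ideal D[X]) [Q.IsPrime] (hQ : Q ≠ ⊥) (hc : Q.comap C = ⊥) :
    Q.height = 1 := by
  apply le_antisymm
  · let K := FractionRing D
    let : Algebra D[X] K[X] := Polynomial.algebra D K
    let M := Submonoid.map (Polynomial.C : D →+* D[X]).toMonoidHom (nonZeroDivisors D)
    have : IsLocalization M K[X] := Polynomial.isLocalization _ _
    have hdisj : Disjoint (M : Set D[X]) (Q : Set D[X]) := by
      rw [Set.disjoint_left]
      rintro _ ⟨d, hd, rfl⟩ hdQ
      have : d ∈ Q.comap C := hdQ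
      rw [hc, Ideal.mem_bot] at this
      exact nonZeroDivisors.ne_zero hd this
    have hprime := IsLocalization.isPrime_of_isPrime_disjoint M K[X] Q ‹_› hdisj
    rw [← IsLocalization.height_map_of_disjoint (S := K[X]) M Q hdisj]
    exact Ideal.height_le_one_of_isPrincipal_of_mem_minimalPrimes (Q.map (algebraMap D[X] K[X])) _
      (by rw [Ideal.minimalPrimes_eq_subsingleton_self]; rfl)
  · rw [Order.one_le_iff_ne_zero, Ne, Ideal.height_eq_zero_iff, IsDomain.minimalPrimes_eq_singleton_bot]
    exact hQ

open Polynomial in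
/-- For a domain `E` generated by one element over a domain `D`, the transcendence degree and
the height of the ideal of relations add up to one. -/
theorem Polynomial.trdeg_add_height_ker {D E : Type*} [CommRing D] [IsDomain D]
    [IsNoetherianRing D] [CommRing E] [IsDomain E] [Algebra D E] [FaithfulSMul D E]
    (g : D[X] →ₐ[D] E) (hg : Function.Surjective g) :
    ∃ a b : ℕ, Algebra.trdeg D E = a ∧ (RingHom.ker g).height = b ∧ a + b = 1 := by
  by_cases h : RingHom.ker g = ⊥
  · refine ⟨1, 0, ?_, by rw [h, Ideal.height_bot, Nat.cast_zero], rfl⟩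
    have e : D[X] ≃ₐ[D] E := AlgEquiv.ofBijective g ⟨(RingHom.injective_iff_ker_eq_bot g).2 h, hg⟩
    have h1 := e.lift_trdeg_eq
    rw [Polynomial.trdeg_of_isDomain, Cardinal.lift_one] at h1
    simpa using h1.symm
  · have : (RingHom.ker g).IsPrime := RingHom.ker_isPrime g
    refine ⟨0, 1, ?_, ?_, rfl⟩
    · have : Algebra.IsAlgebraic D E := by
        obtain ⟨f, hf, hf0⟩ := Submodule.exists_mem_ne_zero_of_ne_bot h
        have hX : IsAlgebraic D (g X) := ⟨f, hf0, by rw [← hf, aeval_algHom_apply, aeval_X_left_apply]⟩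
        refine ⟨fun y => ?_⟩
        obtain ⟨y, rfl⟩ := hg y
        rw [← aeval_X_left_apply y, ← aeval_algHom_apply]
        exact Algebra.isAlgebraic_adjoin_singleton_iff.2 hX _ (aeval_mem_adjoin_singleton D _)
      rw [trdeg_eq_zero, Nat.cast_zero]
    · rw [Polynomial.height_eq_one_of_comap_C_eq_bot _ h, Nat.cast_one]
      rw [Ideal.comap, eq_bot_iff]
      intro d hd
      have h1 : g (C d) = 0 := hd
      rw [← algebraMap_eq, AlgHom.commutes] at h1
      exact (FaithfulSMul.algebraMap_injective D E) (h1.trans (map_zero _).symm)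

/-- Quotients of the source and the target of a surjective algebra map by corresponding ideals
have the same transcendence degree over the quotient of the base. -/
theorem trdeg_quotient_comap_of_surjective {A B C : Type*} [CommRing A] [CommRing B] [CommRing C]
    [Algebra A B] [Algebra A C] (f : B →ₐ[A] C) (hf : Function.Surjective f) (p : Ideal A)
    (Q : Ideal C) [Q.LiesOver p] (P : Ideal B) [P.LiesOver p] (hP : P = Q.comap f) :
    Cardinal.toENat (Algebra.trdeg (A ⧸ p) (B ⧸ P)) =
      Cardinal.toENat (Algebra.trdeg (A ⧸ p) (C ⧸ Q)) := by
  let φ : (B ⧸ P) →ₐ[A ⧸ p] (C ⧸ Q) :=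
    { Ideal.quotientMap Q (f : B →+* C) hP.le with
      commutes' := by
        intro a
        obtain ⟨a, rfl⟩ := Ideal.Quotient.mk_surjective a
        change Ideal.Quotient.mk Q (f (algebraMap A B a)) = Ideal.Quotient.mk Q (algebraMap A C a)
        rw [f.commutes] }
  have hφ : Function.Bijective φ := by
    refine ⟨Ideal.quotientMap_injective' (f := (f : B →+* C)) (H := hP.le) hP.ge, ?_⟩
    exact Ideal.quotientMap_surjective (f := (f : B →+* C)) (H := hP.le) hf
  have := (AlgEquiv.ofBijective φ hφ).lift_trdeg_eq
  simpa using congrArg Cardinal.toENat this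

/-- The dimension formula for the primes of an algebra `R` of relative dimension `N` over `A`. -/
def SatisfiesDimensionFormula (A R : Type*) [CommRing A] [CommRing R] [Algebra A R] (N : ℕ) :
    Prop :=
  ∀ (P : Ideal R) [P.IsPrime] (p : Ideal A) [P.LiesOver p],
    Cardinal.toENat (Algebra.trdeg (A ⧸ p) (R ⧸ P)) + P.height = p.height + N

theorem SatisfiesDimensionFormula.of_algEquiv {A R R' : Type*} [CommRing A] [CommRing R]
    [Algebra A R] [CommRing R'] [Algebra A R'] {N : ℕ} (h : SatisfiesDimensionFormula A R N)
    (e : R ≃ₐ[A] R') : SatisfiesDimensionFormula A R' N := by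
  intro P _ p _
  have h1 := h (P.comap e) p
  rwa [trdeg_quotient_comap_of_surjective (e : R →ₐ[A] R') e.surjective p P (P.comap e) rfl,
    show (P.comap e).height = P.height from e.toRingEquiv.height_comap P] at h1

theorem satisfiesDimensionFormula_self (A : Type*) [CommRing A] :
    SatisfiesDimensionFormula A A 0 := by
  intro P _ p hp
  obtain rfl : p = P := hp.over
  have := hp.over
  have : Algebra.IsAlgebraic (A ⧸ p) (A ⧸ p) := inferInstance
  have h0 : Algebra.trdeg (A ⧸ p) (A ⧸ p) = 0 := trdeg_eq_zero
  have : Nontrivial (A ⧸ p) := inferInstance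
  -- The algebra structure coming from `LiesOver` is not syntactically the identity one, but the two
  -- agree on classes.
  have h1 : @Algebra.trdeg (A ⧸ p) (A ⧸ p) _ _ (Ideal.Quotient.algebraOfLiesOver p p) = 0 := by
    convert h0
    refine Algebra.algebra_ext _ _ fun a => ?_
    obtain ⟨a, rfl⟩ := Ideal.Quotient.mk_surjective a
    rfl
  rw [h1]
  simp

open Polynomial in
-- With q = P ∩ R, going down splits ht P into ht q and the height of the image of P in (R/q)[X].
-- Transcendence degree is additive in towers, and the two increments over q add up to one.
theorem SatisfiesDimensionFormula.polynomial {A : Type*} {R : Type*} [CommRing A]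
    [CommRing R] [Algebra A R] [IsNoetherianRing R] {N : ℕ}
    (h : SatisfiesDimensionFormula A R N) : SatisfiesDimensionFormula A R[X] (N + 1) := by
  intro P _ p _
  let q := P.under R
  have hp : p.IsPrime := Ideal.isPrime_of_liesOver P p
  have h1 := h q p
  let g : (R ⧸ q)[X] →ₐ[R ⧸ q] (R[X] ⧸ P) := aeval (Ideal.Quotient.mk P X)
  have hgmap : ∀ f : R[X], g (f.map (Ideal.Quotient.mk q)) = Ideal.Quotient.mk P f := by
    intro f
    induction f using Polynomial.induction_on' with
    | add f₁ f₂ h₁ h₂ => rw [Polynomial.map_add, map_add, h₁, h₂, map_add]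
    | monomial n r =>
      rw [Polynomial.map_monomial, aeval_monomial, ← C_mul_X_pow_eq_monomial, map_mul, map_pow]
      rfl
  have hg : Function.Surjective g := by
    intro y
    obtain ⟨y, rfl⟩ := Ideal.Quotient.mk_surjective y
    exact ⟨_, hgmap y⟩
  have hmapsurj : Function.Surjective (mapRingHom (Ideal.Quotient.mk q)) :=
    Polynomial.map_surjective _ Ideal.Quotient.mk_surjective
  have hker : P.map (mapRingHom (Ideal.Quotient.mk q)) = RingHom.ker g := by
    apply le_antisymm
    · rw [Ideal.map_le_iff_le_comap]
      intro f hf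
      change g (f.map (Ideal.Quotient.mk q)) = 0
      rw [hgmap, Ideal.Quotient.eq_zero_iff_mem.2 hf]
    · intro y hy
      obtain ⟨f, rfl⟩ := hmapsurj y
      refine Ideal.mem_map_of_mem _ ?_
      have h2 : g (f.map (Ideal.Quotient.mk q)) = 0 := hy
      rwa [hgmap, Ideal.Quotient.eq_zero_iff_mem] at h2
  obtain ⟨a, b, ha, hb, hab⟩ := Polynomial.trdeg_add_height_ker g hg
  have hheight : P.height = q.height + b := by
    rw [Ideal.height_eq_height_add_of_liesOver_of_hasGoingDown q P, ← hb, ← hker]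
    congr 1
    let e : (R[X] ⧸ q.map (algebraMap R R[X])) ≃+* (R ⧸ q)[X] :=
      (Ideal.polynomialQuotientEquivQuotientPolynomial q).symm
    have he : (e : (R[X] ⧸ q.map (algebraMap R R[X])) →+* (R ⧸ q)[X]).comp
        (Ideal.Quotient.mk (q.map (algebraMap R R[X]))) = mapRingHom (Ideal.Quotient.mk q) := by
      ext x : 2
      · simp [e]
      · simp [e]
    rw [← he, ← Ideal.map_map]
    exact (e.height_map _).symm
  have : IsScalarTower (A ⧸ p) (R ⧸ q) (R[X] ⧸ P) := .of_algebraMap_eq fun a => by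
    obtain ⟨a, rfl⟩ := Ideal.Quotient.mk_surjective a
    exact congrArg (Ideal.Quotient.mk P) (IsScalarTower.algebraMap_apply A R R[X] a)
  rw [← trdeg_add_eq (A ⧸ p) (R ⧸ q) (A := R[X] ⧸ P), map_add, ha, hheight]
  calc _ = (Cardinal.toENat (Algebra.trdeg (A ⧸ p) (R ⧸ q)) + q.height) + ((a + b : ℕ) : ℕ∞) := by
        push_cast
        simp only [map_natCast]
        ring
    _ = _ := by
        rw [h1, hab]
        push_cast
        ring

theorem satisfiesDimensionFormula_mvPolynomial (A : Type*) [CommRing A] [IsNoetherianRing A]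
    (n : ℕ) : SatisfiesDimensionFormula A (MvPolynomial (Fin n) A) n := by
  induction n with
  | zero =>
    exact (satisfiesDimensionFormula_self A).of_algEquiv (MvPolynomial.isEmptyAlgEquiv A _).symm
  | succ n ih =>
    exact ih.polynomial.of_algEquiv (MvPolynomial.finSuccEquiv A n).symm

theorem IsDiscreteValuationRing.ringKrullDim_quotient_add_height {A : Type*} [CommRing A]
    [IsDomain A] [IsDiscreteValuationRing A] (p : Ideal A) [p.IsPrime] :
    ringKrullDim (A ⧸ p) + (p.height : WithBot ℕ∞) = 1 := by
  have hA := IsPrincipalIdealRing.ringKrullDim_eq_one A (IsDiscreteValuationRing.not_isField A)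
  by_cases hp : p = ⊥
  · subst hp
    rw [Ideal.height_bot, ringKrullDim_eq_of_ringEquiv (RingEquiv.quotientBot A), hA]
    simp
  · have hmax : p.IsMaximal := IsPrime.to_maximal_ideal hp
    rw [IsLocalRing.eq_maximalIdeal hmax, IsLocalRing.maximalIdeal_height_eq_ringKrullDim, hA]
    have : ringKrullDim (A ⧸ IsLocalRing.maximalIdeal A) = 0 :=
      ringKrullDim_eq_zero_of_isField ((Ideal.Quotient.maximal_ideal_iff_isField_quotient _).1
        inferInstance)
    rw [this, zero_add]

/-- In dim A/p + trdeg + ht P, the dimension formula turns the last two terms into ht p + n, and dim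
A/p + ht p = 1. -/
theorem componentDim_add_height {A : Type*} [CommRing A] [IsDomain A]
    [IsDiscreteValuationRing A] {n : ℕ} (I : Ideal (MvPolynomial (Fin n) A))
    (P : Ideal (MvPolynomial (Fin n) A ⧸ I)) [P.IsPrime] :
    componentDim A P + ((P.comap (Ideal.Quotient.mk I)).height : WithBot ℕ∞) =
      ((n + 1 : ℕ) : WithBot ℕ∞) := by
  let P' := P.comap (Ideal.Quotient.mk I)
  let p := P.under A
  have hP' : P'.LiesOver p := by
    refine ⟨?_⟩
    change P.comap (algebraMap A (MvPolynomial (Fin n) A ⧸ I)) = _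
    rw [IsScalarTower.algebraMap_eq A (MvPolynomial (Fin n) A) (MvPolynomial (Fin n) A ⧸ I),
      ← Ideal.comap_comap]
    rfl
  have h1 := satisfiesDimensionFormula_mvPolynomial A n P' p
  have h2 := trdeg_quotient_comap_of_surjective (Ideal.Quotient.mkₐ A I)
    (Ideal.Quotient.mkₐ_surjective A I) p P P' rfl
  have h3 := IsDiscreteValuationRing.ringKrullDim_quotient_add_height p
  rw [h2] at h1
  rw [componentDim, add_assoc, ← WithBot.coe_add, h1, WithBot.coe_add, ← add_assoc, h3]
  push_cast
  rw [add_comm]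

theorem height_eq_of_mem_minimalPrimes_of_isEquidimensionalOver {A : Type*} [CommRing A]
    [IsDomain A] [IsDiscreteValuationRing A] {n : ℕ} {I : Ideal (MvPolynomial (Fin n) A)}
    (hI : IsEquidimensionalOver A (MvPolynomial (Fin n) A ⧸ I))
    {P : Ideal (MvPolynomial (Fin n) A)} (hP : P ∈ I.minimalPrimes) : P.height = I.height := by
  have key : ∀ Q ∈ I.minimalPrimes, Q.height = P.height := by
    intro Q hQ
    rw [Ideal.minimalPrimes_eq_comap] at hP hQ
    obtain ⟨P, hP, rfl⟩ := hP
    obtain ⟨Q, hQ, rfl⟩ := hQ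
    have := hP.isPrime
    have := hQ.isPrime
    have h1 := componentDim_add_height I P
    have h2 := componentDim_add_height I Q
    rw [hI P hP Q hQ] at h1
    generalize componentDim A Q = c at h1 h2
    generalize (P.comap (Ideal.Quotient.mk I)).height = a at h1 h2 ⊢
    generalize (Q.comap (Ideal.Quotient.mk I)).height = b at h1 h2 ⊢
    -- The common dimension must be finite before it can be cancelled.
    induction c with
    | bot =>
      rw [WithBot.bot_add] at h1
      exact absurd h1 (WithBot.bot_ne_coe (a := ((n + 1 : ℕ) : ℕ∞)))
    | coe c =>
      norm_cast at h1 h2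
      have hc : c ≠ ⊤ := by
        rintro rfl
        rw [top_add] at h1
        exact absurd h1 (ENat.top_ne_natCast _)
      exact WithTop.add_left_cancel hc (h2.trans h1.symm)
  rw [I.height_eq_inf_minimalPrimes]
  exact le_antisymm (le_iInf₂ fun Q hQ => (key Q hQ).ge) (iInf₂_le P hP)

/-! ### Embedded primes are the associated primes of U/I -/

section Unmixed

open RingTheory.Sequence

variable {R : Type*} [CommRing R] [IsRegularRing R] {rs : List R} {I : Ideal R}

/-- As J:K is the intersection of the J:g over finitely many generators g of K, a prime associated
to R/(J:K) is associated to R/J. Unmixedness gives it height ht I. -/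
theorem IsRegularRing.mem_minimalPrimes_of_eq_colon_colon (hrs : IsWeaklyRegular R rs)
    (hlen : (rs.length : ℕ∞) = I.height) {K : Ideal R} {P : Ideal R} [P.IsPrime] (hIP : I ≤ P)
    {x : R} (hP : ∀ r, r ∈ P ↔ r * x ∈ (Ideal.ofList rs).colon (K : Set R)) :
    P ∈ I.minimalPrimes := by
  obtain ⟨G, hG⟩ := K.fg_of_isNoetherianRing
  have hinf : G.inf (fun g => (Ideal.ofList rs).colon {x * g}) ≤ P := by
    intro r hr
    rw [hP, Submodule.mem_colon]
    have hle : K ≤ (Ideal.ofList rs).colon {r * x} := by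
      rw [← hG]
      refine Submodule.span_le.2 fun g hg => ?_
      have := Submodule.mem_colon_singleton.1 ((Submodule.mem_finsetInf.1 hr) g hg)
      rw [SetLike.mem_coe, Submodule.mem_colon_singleton]
      convert this using 1
      simp only [smul_eq_mul]
      ring
    intro k hk
    have := Submodule.mem_colon_singleton.1 (hle hk)
    rwa [smul_eq_mul, mul_comm] at this
  obtain ⟨g, hg, hgP⟩ := (Ideal.IsPrime.inf_le' ‹_›).1 hinf
  have hPg : ∀ r, r ∈ P ↔ r * (x * g) ∈ Ideal.ofList rs := by
    refine fun r => ⟨fun hr => ?_, fun hr => hgP (Submodule.mem_colon_singleton.2 hr)⟩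
    rw [← mul_assoc]
    exact Submodule.mem_colon.1 ((hP r).1 hr) g (hG ▸ Submodule.subset_span hg)
  have hht := IsRegularRing.height_eq_length hrs hPg
  have : P.FiniteHeight := ⟨Or.inr (by rw [hht]; exact ENat.natCast_ne_top _)⟩
  exact Ideal.mem_minimalPrimes_of_height_le hIP (by rw [hht, hlen])

/-- An associated prime of `R / I` that is not minimal is associated to `(J : (J : I)) / I`. -/
theorem IsRegularRing.exists_mem_colon_colon_of_notMem_minimalPrimes
    (hrs : IsWeaklyRegular R rs) (hlen : (rs.length : ℕ∞) = I.height) {P : Ideal R} [P.IsPrime]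
    {x : R} (hP : ∀ r, r ∈ P ↔ r * x ∈ I) (hmin : P ∉ I.minimalPrimes) :
    ∃ y ∈ (Ideal.ofList rs).colon ((Ideal.ofList rs).colon (I : Set R) : Set R),
      ∀ r, r ∈ P ↔ r * y ∈ I := by
  have hIU : I ≤ (Ideal.ofList rs).colon ((Ideal.ofList rs).colon (I : Set R) : Set R) := by
    intro r hr
    rw [Submodule.mem_colon]
    intro k hk
    have := Submodule.mem_colon.1 hk r hr
    rwa [smul_eq_mul, mul_comm] at this
  -- If some s outside P moves x into U, then sx has the same annihilator modulo I as x. Otherwise P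
  -- is also the annihilator of x modulo U, which would make it minimal.
  by_cases h : ∃ s ∉ P, s * x ∈
      (Ideal.ofList rs).colon ((Ideal.ofList rs).colon (I : Set R) : Set R)
  · obtain ⟨s, hs, hsx⟩ := h
    refine ⟨s * x, hsx, fun r => ?_⟩
    rw [← mul_assoc, ← hP]
    exact ⟨fun hr => Ideal.mul_mem_right _ _ hr,
      fun hr => (Ideal.IsPrime.mem_or_mem ‹_› hr).resolve_right hs⟩
  · push Not at h
    refine absurd (IsRegularRing.mem_minimalPrimes_of_eq_colon_colon hrs hlen
      (fun r hr => (hP r).2 (I.mul_mem_right _ hr)) (x := x)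
      (K := (Ideal.ofList rs).colon (I : Set R)) fun r => ⟨fun hr => hIU ((hP r).1 hr), fun hr => ?_⟩) hmin
    by_contra hrP
    exact h r hrP hr

/-- Any associated prime of the nonzero image of W ∩ U in R/I works: at a minimal prime of I an
element of U already lies in I. The ideal W allows for both ⊤ and I:τ. -/
theorem IsRegularRing.exists_isPrime_of_inf_colon_colon_not_le (hrs : IsWeaklyRegular R rs)
    (hlen : (rs.length : ℕ∞) = I.height) (hJI : Ideal.ofList rs ≤ I)
    (hht : ∀ P ∈ I.minimalPrimes, P.height = I.height) {W : Ideal R}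
    (hW : ¬ W ⊓ (Ideal.ofList rs).colon ((Ideal.ofList rs).colon (I : Set R) : Set R) ≤ I) :
    ∃ P : Ideal R, P.IsPrime ∧ P ∉ I.minimalPrimes ∧ ∃ x ∈ W, ∀ r, r ∈ P ↔ r * x ∈ I := by
  set U := (Ideal.ofList rs).colon ((Ideal.ofList rs).colon (I : Set R) : Set R) with hU
  let N : Submodule R (R ⧸ I) := Submodule.map (Submodule.mkQ I) (W ⊓ U)
  have hN : Nontrivial N := by
    rw [Submodule.nontrivial_iff_ne_bot, Ne, ← LinearMap.le_ker_iff_map,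
      Submodule.ker_mkQ]
    exact hW
  obtain ⟨P, hP⟩ := associatedPrimes.nonempty R N
  obtain ⟨hprime, ⟨v, hv⟩, hPv⟩ := isAssociatedPrime_iff.1 hP
  obtain ⟨x, ⟨hxW, hxU⟩, rfl⟩ := hv
  have hPx : ∀ r, r ∈ P ↔ r * x ∈ I := by
    intro r
    rw [hPv, Submodule.mem_colon_singleton, Submodule.mem_bot, ← Submodule.Quotient.mk_eq_zero I]
    exact Subtype.ext_iff
  refine ⟨P, hprime, fun hmin => ?_, x, hxW, hPx⟩
  obtain ⟨s, hs, hsx⟩ := IsRegularRing.exists_mul_mem_of_mem_colon_colon hrs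
    ((hht P hmin).trans hlen.symm) hJI hmin.le hxU
  exact hs ((hPx s).2 hsx)

end Unmixed

/-! ### Passage to the quotient ring and the three equivalences -/

theorem mem_embeddedPrimes_quotient_iff {R : Type*} [CommRing R] [IsNoetherianRing R]
    {I : Ideal R} {P : Ideal (R ⧸ I)} :
    P ∈ embeddedPrimes (R ⧸ I) ↔ (P.comap (Ideal.Quotient.mk I)).IsPrime ∧
      P.comap (Ideal.Quotient.mk I) ∉ I.minimalPrimes ∧
      ∃ x, ∀ r, r ∈ P.comap (Ideal.Quotient.mk I) ↔ r * x ∈ I := by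
  have hprime : (P.comap (Ideal.Quotient.mk I)).IsPrime ↔ P.IsPrime :=
    ⟨fun h => Ideal.map_comap_of_surjective _ Ideal.Quotient.mk_surjective P ▸
      Ideal.map_isPrime_of_surjective Ideal.Quotient.mk_surjective (by
        rw [Ideal.mk_ker]
        intro r hr
        rw [Ideal.mem_comap, Ideal.Quotient.eq_zero_iff_mem.2 hr]
        exact zero_mem _), fun h => inferInstance⟩
  have hmin : P.comap (Ideal.Quotient.mk I) ∈ I.minimalPrimes ↔ P ∈ minimalPrimes (R ⧸ I) := by
    rw [Ideal.minimalPrimes_eq_comap,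
      (Ideal.comap_injective_of_surjective _ Ideal.Quotient.mk_surjective).mem_set_image]
  rw [hprime, hmin, embeddedPrimes, Set.mem_sdiff, AssociatedPrimes.mem_iff, isAssociatedPrime_iff]
  have hex : (∃ y : R ⧸ I, P = (⊥ : Ideal (R ⧸ I)).colon {y}) ↔
      ∃ x, ∀ r, r ∈ P.comap (Ideal.Quotient.mk I) ↔ r * x ∈ I := by
    rw [Ideal.Quotient.mk_surjective.exists]
    refine exists_congr fun x => ?_
    rw [SetLike.ext_iff, Ideal.Quotient.mk_surjective.forall]
    refine forall_congr' fun r => ?_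
    rw [Submodule.mem_colon_singleton, Submodule.mem_bot, smul_eq_mul, ← map_mul,
      Ideal.Quotient.eq_zero_iff_mem, Ideal.mem_comap]
  rw [← hex]
  tauto

theorem IsDiscreteValuationRing.mem_of_isPrime_of_ne_bot {A : Type*} [CommRing A] [IsDomain A]
    [IsDiscreteValuationRing A] {τ : A} (hτ : Irreducible τ) {p : Ideal A} [p.IsPrime]
    (hp : p ≠ ⊥) : τ ∈ p := by
  have hmax : p.IsMaximal := IsPrime.to_maximal_ideal hp
  rw [IsLocalRing.eq_maximalIdeal hmax]
  exact hτ.not_isUnit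

/-- Nonzero elements are units times powers of τ, so injectivity of τ gives torsion-freeness, which
is flatness here. -/
theorem IsDiscreteValuationRing.flat_iff_isSMulRegular {A M : Type*} [CommRing A] [IsDomain A]
    [IsDiscreteValuationRing A] [AddCommGroup M] [Module A M] {τ : A} (hτ : Irreducible τ) :
    Module.Flat A M ↔ IsSMulRegular M τ := by
  refine ⟨fun _ => Module.Flat.isSMulRegular_of_nonZeroDivisors
    (mem_nonZeroDivisors_of_ne_zero hτ.ne_zero), fun h => ?_⟩
  have : Module.IsTorsionFree A M := by
    refine ⟨fun r hr => ?_⟩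
    obtain ⟨k, u, rfl⟩ := eq_unit_mul_pow_irreducible hr.ne_zero hτ
    exact (IsUnit.isSMulRegular M u.isUnit).mul (h.pow k)
  infer_instance

theorem proposition3p1 {A : Type*} [CommRing A] [IsDomain A] [IsDiscreteValuationRing A]
    (τ : A) (hτ : Irreducible τ) (n : ℕ)
    (I J : Ideal (MvPolynomial (Fin n) A))
    (hI : IsEquidimensionalOver A (MvPolynomial (Fin n) A ⧸ I))
    (hJI : J ≤ I)
    (rs : List (MvPolynomial (Fin n) A))
    (hrs : RingTheory.Sequence.IsRegular (MvPolynomial (Fin n) A) rs)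
    (hJ : J = Ideal.ofList rs)
    (hlen : (rs.length : ℕ∞) = I.height) :
    (HasNoEmbeddedComponents (MvPolynomial (Fin n) A ⧸ I) ↔
      J.colon (J.colon (I : Set (MvPolynomial (Fin n) A)) : Set (MvPolynomial (Fin n) A)) ≤ I) ∧
    (Module.Flat A (MvPolynomial (Fin n) A ⧸ I) ↔
      I.colon {MvPolynomial.C τ} ≤ I) ∧
    (IsInternallyFlat A (MvPolynomial (Fin n) A ⧸ I) ↔
      I.colon {MvPolynomial.C τ} ⊓
        J.colon (J.colon (I : Set (MvPolynomial (Fin n) A)) : Set (MvPolynomial (Fin n) A)) ≤ I) := by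
  subst hJ
  have hht : ∀ P ∈ I.minimalPrimes, P.height = I.height := fun P hP =>
    height_eq_of_mem_minimalPrimes_of_isEquidimensionalOver hI hP
  have hw := hrs.toIsWeaklyRegular
  have hembedded : ∀ P ∈ embeddedPrimes (MvPolynomial (Fin n) A ⧸ I),
      ∃ y ∈ (Ideal.ofList rs).colon ((Ideal.ofList rs).colon (I : Set _) : Set _), y ∉ I ∧
        ∀ r, r ∈ P.comap (Ideal.Quotient.mk I) ↔ r * y ∈ I := by
    intro P hP
    obtain ⟨hprime, hmin, x, hx⟩ := mem_embeddedPrimes_quotient_iff.1 hP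
    obtain ⟨y, hy, hPy⟩ :=
      IsRegularRing.exists_mem_colon_colon_of_notMem_minimalPrimes hw hlen hx hmin
    refine ⟨y, hy, fun hyI => hprime.ne_top ((Ideal.eq_top_iff_one _).2 ?_), hPy⟩
    rw [hPy, one_mul]
    exact hyI
  have hexists : ∀ W : Ideal (MvPolynomial (Fin n) A),
      ¬ W ⊓ (Ideal.ofList rs).colon ((Ideal.ofList rs).colon (I : Set _) : Set _) ≤ I →
      ∃ P ∈ embeddedPrimes (MvPolynomial (Fin n) A ⧸ I), ∃ x ∈ W,
        ∀ r, r ∈ P.comap (Ideal.Quotient.mk I) ↔ r * x ∈ I := by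
    intro W hW
    obtain ⟨P, hprime, hmin, x, hxW, hx⟩ :=
      IsRegularRing.exists_isPrime_of_inf_colon_colon_not_le hw hlen hJI hht hW
    have hcomap : (P.map (Ideal.Quotient.mk I)).comap (Ideal.Quotient.mk I) = P := by
      rw [Ideal.comap_map_of_surjective' _ Ideal.Quotient.mk_surjective, Ideal.mk_ker]
      exact sup_eq_left.2 fun r hr => (hx r).2 (I.mul_mem_right _ hr)
    refine ⟨P.map (Ideal.Quotient.mk I), mem_embeddedPrimes_quotient_iff.2 ?_, x, hxW, ?_⟩
    · rw [hcomap]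
      exact ⟨hprime, hmin, x, hx⟩
    · rw [hcomap]
      exact hx
  refine ⟨⟨fun h => ?_, fun h => ?_⟩, ?_, ⟨fun h => ?_, fun h P hP => ?_⟩⟩
  · by_contra hle
    obtain ⟨P, hP, -⟩ := hexists ⊤ (by rwa [top_inf_eq])
    rw [h] at hP
    exact hP
  · refine Set.eq_empty_iff_forall_notMem.2 fun P hP => ?_
    obtain ⟨y, hy, hyI, -⟩ := hembedded P hP
    exact hyI (h hy)
  · rw [IsDiscreteValuationRing.flat_iff_isSMulRegular hτ]
    have hC : ∀ f : MvPolynomial (Fin n) A, τ • f = MvPolynomial.C τ * f := fun f =>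
      MvPolynomial.smul_eq_C_mul f τ
    rw [isSMulRegular_iff_right_eq_zero_of_smul, Ideal.Quotient.mk_surjective.forall]
    refine forall_congr' fun f => ?_
    rw [Submodule.mem_colon_singleton, smul_eq_mul, mul_comm, ← hC,
      ← Ideal.Quotient.eq_zero_iff_mem, ← Ideal.Quotient.eq_zero_iff_mem]
    rfl
  · by_contra hle
    obtain ⟨P, hP, x, hxW, hx⟩ := hexists _ hle
    -- Since x lies in I:τ, its annihilator P modulo I contains τ.
    have hτP : τ ∈ P.comap (algebraMap A (MvPolynomial (Fin n) A ⧸ I)) := by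
      rw [Submodule.mem_colon_singleton, smul_eq_mul, mul_comm, ← hx] at hxW
      exact hxW
    rw [h P hP, Ideal.mem_bot] at hτP
    exact hτ.ne_zero hτP
  · by_contra hne
    have hprime : P.IsPrime := hP.1.isPrime
    have hτP := IsDiscreteValuationRing.mem_of_isPrime_of_ne_bot hτ hne
    obtain ⟨y, hy, hyI, hPy⟩ := hembedded P hP
    refine hyI (h ⟨?_, hy⟩)
    rw [SetLike.mem_coe, Submodule.mem_colon_singleton, smul_eq_mul, mul_comm, ← hPy]
    exact hτP
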